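/- Let $E\subset\mathbb{C}^4\otimes\mathbb{C}^4$ be a linear space of $4\times4$ complex matrices. Fixing a basis of $E$ with coordinates $x_1,\dots,x_m$, regard $E$ as a $4\times 4$ matrix of linear forms, whose minors are polynomials in $\mathbb{C}[x_1,\dots,x_m]$. Suppose that there is an irreducible polynomial $S\in\mathbb{C}[x_1,\dots,x_m]$ of degree $2$ that divides all $3\times3$ minors of $E$. Then at least one of the following holds: 1. $E$ has bounded rank $3$, i.e. every matrix in $E$ has rank at most $3$; 2. there are $P,Q\in GL_4(\mathbb{C})$ such that every matrix in $PEQ:=\{PMQ : M\in E\}$ is skew-symmetric; 3. $S$ has rank $3$ and there are $P,Q\in GL_4(\mathbb{C})$ such that $$PEQ=\left\{\begin{pmatrix}X&0\\0&X\end{pmatrix} : X=\begin{pmatrix}x_1&x_2\\x_2&x_3\end{pmatrix},\ x_1,x_2,x_3\in\mathbb{C}\right\};$$ 4. $S$ has rank $4$ and there are $P,Q\in GL_4(\mathbb{C})$ such that $$PEQ=\left\{\begin{pmatrix}X&0\\0&X\end{pmatrix} : X=\begin{pmatrix}x_1&x_2\\x_3&x_4\end{pmatrix},\ x_1,\dots,x_4\in\mathbb{C}\right\}.$$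 Here the rank of $S$ is the rank of the quadratic form given by its degree-$2$ part. -/

import Mathlib

noncomputable section

/-- The matrix of linear forms of a linear space `E` of `4 × 4` matrices with respect to a basis
`b` of `E`: the sum `∑ k, x_k b_k` in the coordinates `x_k` on `E`. Its minors are the minors
of `E`, as polynomials on `E`. -/
def linearFormMatrix {m : ℕ} {E : Submodule ℂ (Matrix (Fin 4) (Fin 4) ℂ)}
    (b : Module.Basis (Fin m) ℂ E) : Matrix (Fin 4) (Fin 4) (MvPolynomial (Fin m) ℂ) :=
  Matrix.of fun i j =>
    ∑ k, MvPolynomial.C ((b k : Matrix (Fin 4) (Fin 4) ℂ) i j) * MvPolynomial.X k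

/-- The rank of a quadric `S`: the rank of the symmetric matrix of second partial derivatives
of `S` (evaluated at the origin; these are constants when `S` has degree two). This is twice the
Gram matrix of the quadratic part of `S`. -/
def quadricRank {m : ℕ} (S : MvPolynomial (Fin m) ℂ) : ℕ :=
  (Matrix.of fun i j : Fin m =>
    MvPolynomial.constantCoeff (MvPolynomial.pderiv i (MvPolynomial.pderiv j S))).rank

/-- All matrices of the space `E` have rank at most `r`. -/
def HasBoundedRank (E : Submodule ℂ (Matrix (Fin 4) (Fin 4) ℂ)) (r : ℕ) : Prop :=
  ∀ M ∈ E, M.rank ≤ r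

/-- All matrices of the space `E` are skew-symmetric. -/
def IsSkewSpace (E : Submodule ℂ (Matrix (Fin 4) (Fin 4) ℂ)) : Prop :=
  ∀ M ∈ E, M.transpose = -M

/-- `F` is obtained from `E` by changes of bases in the two factors of `ℂ⁴ ⊗ ℂ⁴`, that is,
`F = P E Q` as linear spaces. (No basis of `E` is involved, so that changes of bases in `E`
are allowed.) -/
def EqUpToBases (E F : Submodule ℂ (Matrix (Fin 4) (Fin 4) ℂ)) : Prop :=
  ∃ P Q : GL (Fin 4) ℂ,
    E.map (LinearMap.mulLeft ℂ (P : Matrix (Fin 4) (Fin 4) ℂ) ∘ₗ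
      LinearMap.mulRight ℂ (Q : Matrix (Fin 4) (Fin 4) ℂ)) = F

/-- The space of all `diag(X, X)` with `X` a symmetric `2 × 2` matrix. -/
def diagSymmSpace : Submodule ℂ (Matrix (Fin 4) (Fin 4) ℂ) where
  carrier := {M | ∃ x₁ x₂ x₃ : ℂ,
    M = !![x₁, x₂, 0, 0;
           x₂, x₃, 0, 0;
           0, 0, x₁, x₂;
           0, 0, x₂, x₃]}
  zero_mem' := ⟨0, 0, 0, by ext i j; fin_cases i <;> fin_cases j <;> simp⟩
  add_mem' := by
    rintro _ _ ⟨a, b, c, rfl⟩ ⟨a', b', c', rfl⟩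
    exact ⟨a + a', b + b', c + c', by ext i j; fin_cases i <;> fin_cases j <;> simp⟩
  smul_mem' := by
    rintro t _ ⟨a, b, c, rfl⟩
    exact ⟨t * a, t * b, t * c, by ext i j; fin_cases i <;> fin_cases j <;> simp⟩

/-- The space of all `diag(X, X)` with `X` an arbitrary `2 × 2` matrix. -/
def diagGeneralSpace : Submodule ℂ (Matrix (Fin 4) (Fin 4) ℂ) where
  carrier := {M | ∃ x₁ x₂ x₃ x₄ : ℂ,
    M = !![x₁, x₂, 0, 0;
           x₃, x₄, 0, 0;
           0, 0, x₁, x₂;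
           0, 0, x₃, x₄]}
  zero_mem' := ⟨0, 0, 0, 0, by ext i j; fin_cases i <;> fin_cases j <;> simp⟩
  add_mem' := by
    rintro _ _ ⟨a, b, c, d, rfl⟩ ⟨a', b', c', d', rfl⟩
    exact ⟨a + a', b + b', c + c', d + d', by
      ext i j; fin_cases i <;> fin_cases j <;> simp⟩
  smul_mem' := by
    rintro t _ ⟨a, b, c, d, rfl⟩
    exact ⟨t * a, t * b, t * c, t * d, by ext i j; fin_cases i <;> fin_cases j <;> simp⟩

end

/-! Let `A` be the generic matrix of `E`. If `det A = 0`, then `E` has bounded rank 3. Otherwise `S`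
divides `adj A`, so `N * A = T • 1` with `det A = S * T`; determinants give `S ∣ T ^ 3`, and degrees
force `T = c * S`. Thus `det A = c * S ^ 2` and `A` is half of a matrix factorization of `c * S`
(`exists_matrix_factorization`).

Fix an invertible `M₀ ∈ E`. On the pencil `X * M₀ - M` the factorization says that `Y = M₀⁻¹ * M` is
killed by a quadratic polynomial whose square is, up to a scalar, its characteristic polynomial. If
`Y` is traceless, `Y * Y` is therefore scalar (`sq_inv_mul_eq_smul_one`). So squaring is a quadratic
form on the traceless part of `M₀⁻¹ E`, as in a Clifford algebra. If its rank is at most one, `det`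
is a scalar times the square of a product of two linear forms, against irreducibility of `S`.
Otherwise there are two anticommuting involutions, conjugate to `1 ⊗ σ_z` and `1 ⊗ σ_x`.

Their orthogonal complement anticommutes with both, hence consists of matrices `K ⊗ ε` with `ε =
!![0, 1; -1, 0]`, and each `K ^ 2` is scalar. Either every `K` is traceless, and `ε ⊗ 1` carries the
space to skew matrices, or some `K`, and then every `K`, is scalar, and the space is
`diagGeneralSpace`. The symmetric alternative never has to be produced: for symmetric `X`, `(ε ⊗ 1)
* diag(X, X)` is skew, so it falls under the skew case. -/

/-! ### Determinant and matrix factorization. -/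

theorem totalDegree_det_linearFormMatrix_le {m : ℕ}
    {E : Submodule ℂ (Matrix (Fin 4) (Fin 4) ℂ)} (b : Module.Basis (Fin m) ℂ E) :
    (linearFormMatrix b).det.totalDegree ≤ 4 := by
  have hlin : ∀ i j, (linearFormMatrix b i j).IsHomogeneous 1 := fun i j => by
    refine MvPolynomial.IsHomogeneous.sum (Finset.univ : Finset (Fin m)) _ 1 fun k _ => ?_
    simpa using (MvPolynomial.isHomogeneous_C (Fin m) _).mul (MvPolynomial.isHomogeneous_X ℂ k)
  have hdet : (linearFormMatrix b).det.IsHomogeneous 4 := by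
    rw [Matrix.det_apply']
    refine MvPolynomial.IsHomogeneous.sum _ _ _ fun σ _ => ?_
    have hprod : (∏ i, linearFormMatrix b (σ i) i).IsHomogeneous 4 := by
      simpa using MvPolynomial.IsHomogeneous.prod Finset.univ
        (fun i => linearFormMatrix b (σ i) i) (fun _ => 1) fun i _ => hlin _ _
    have hsign : (((Equiv.Perm.sign σ : ℤ) : MvPolynomial (Fin m) ℂ)).IsHomogeneous 0 := by
      have := MvPolynomial.isHomogeneous_C (Fin m) (((Equiv.Perm.sign σ : ℤ) : ℂ))
      simpa using this
    simpa using hsign.mul hprod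
  exact hdet.totalDegree_le

/-- If an irreducible quadric divides all `3 × 3` minors of a nondegenerate matrix of linear
forms of size four, then its square is the determinant up to a scalar, and the matrix is a factor
in a matrix factorization of the quadric. -/
theorem exists_matrix_factorization {m : ℕ}
    (A : Matrix (Fin 4) (Fin 4) (MvPolynomial (Fin m) ℂ))
    {S : MvPolynomial (Fin m) ℂ} (hirr : Irreducible S) (hdeg : S.totalDegree = 2)
    (hdet : A.det ≠ 0) (hle : A.det.totalDegree ≤ 4)
    (hdvd : ∀ f g : Fin 3 ↪o Fin 4, S ∣ (A.submatrix f g).det) :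
    ∃ c : ℂ, c ≠ 0 ∧ A.det = MvPolynomial.C c * S ^ 2 ∧
      ∃ N : Matrix (Fin 4) (Fin 4) (MvPolynomial (Fin m) ℂ),
        N * A = (MvPolynomial.C c * S) • (1 : Matrix (Fin 4) (Fin 4) _) := by
  have hS0 : S ≠ 0 := hirr.ne_zero
  have hadj : ∀ i j, ∃ q, A.adjugate i j = S * q := fun i j => by
    rw [Matrix.adjugate_fin_succ_eq_det_submatrix]
    exact Dvd.dvd.mul_left (hdvd (Fin.succAboveOrderEmb j) (Fin.succAboveOrderEmb i)) _
  choose N hN using hadj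
  have hN' : A.adjugate = S • Matrix.of N := by
    ext1 i j
    simpa using hN i j
  have hNA : S • (Matrix.of N * A) = A.det • (1 : Matrix (Fin 4) (Fin 4) _) := by
    rw [← Matrix.smul_mul, ← hN', Matrix.adjugate_mul]
  have hST : S ∣ A.det := by
    refine ⟨(Matrix.of N * A) 0 0, ?_⟩
    simpa using (congrFun (congrFun hNA 0) 0).symm
  obtain ⟨T, hT⟩ := hST
  have hNT : Matrix.of N * A = T • (1 : Matrix (Fin 4) (Fin 4) _) := by
    have h : S • (Matrix.of N * A) = S • (T • (1 : Matrix (Fin 4) (Fin 4) _)) := by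
      rw [hNA, hT, smul_smul]
    exact smul_right_injective _ hS0 h
  have hT0 : T ≠ 0 := by
    rintro rfl
    exact hdet (by simpa using hT)
  -- Determinants of `hNT` give `det N * (S * T) = T ^ 4`; cancel one `T`.
  have hT3 : (Matrix.of N).det * S = T ^ 3 := by
    have h := congrArg Matrix.det hNT
    rw [Matrix.det_mul, Matrix.det_smul, Matrix.det_one, hT] at h
    refine mul_right_cancel₀ hT0 ?_
    simp only [Fintype.card_fin] at h
    linear_combination h
  have hdT : S ∣ T := hirr.prime.dvd_of_dvd_pow ⟨_, by rw [← hT3, mul_comm]⟩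
  obtain ⟨U, hU⟩ := hdT
  have hU0 : U ≠ 0 := by
    rintro rfl
    exact hT0 (by simpa using hU)
  -- `det A = S * S * U` has degree at most 4, and the two factors `S` already use it up.
  have hUdeg : U.totalDegree = 0 := by
    rw [hT, hU, MvPolynomial.totalDegree_mul_of_isDomain hS0 (mul_ne_zero hS0 hU0),
      MvPolynomial.totalDegree_mul_of_isDomain hS0 hU0, hdeg] at hle
    omega
  rw [MvPolynomial.totalDegree_eq_zero_iff_eq_C] at hUdeg
  refine ⟨U.coeff 0, fun h => hU0 (by rw [hUdeg, h, map_zero]), ?_, Matrix.of N, ?_⟩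
  · rw [← hUdeg, hT, hU]; ring
  · rw [← hUdeg, hNT, hU, mul_comm]

/-! ### Scalar squares from pencils. -/

/-- The Cayley–Hamilton argument: read as polynomials with matrix coefficients, the right factor `X
- Y` vanishes on evaluation at `Y`. -/
theorem Matrix.aeval_eq_zero_of_mul_charmatrix {n R : Type*} [CommRing R] [Fintype n]
    [DecidableEq n] {Y : Matrix n n R} {B : Matrix n n (Polynomial R)} {p : Polynomial R}
    (h : B * Y.charmatrix = p • (1 : Matrix n n (Polynomial R))) : Polynomial.aeval Y p = 0 := by
  apply_fun matPolyEquiv at h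
  simp only [map_mul, matPolyEquiv_charmatrix] at h
  apply_fun fun p => p.eval Y at h
  rw [Polynomial.eval_mul_X_sub_C, matPolyEquiv_smul_one, Polynomial.eval_map] at h
  exact h.symm

/-- A traceless `4 × 4` matrix annihilated by a polynomial whose square is, up to a scalar, the
characteristic polynomial, has scalar square. -/
theorem sq_eq_smul_one_of_charpoly_eq {Y : Matrix (Fin 4) (Fin 4) ℂ} {p : Polynomial ℂ} {k : ℂ}
    (hp : Y.charpoly = Polynomial.C k * p ^ 2) (hY : Polynomial.aeval Y p = 0)
    (htr : Y.trace = 0) :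
    ∃ d : ℂ, Y * Y = d • (1 : Matrix (Fin 4) (Fin 4) ℂ) ∧
      ∀ t : ℂ, (t • (1 : Matrix (Fin 4) (Fin 4) ℂ) + Y).det = (t ^ 2 - d) ^ 2 := by
  have hk : k ≠ 0 := by
    rintro rfl
    exact Y.charpoly_monic.ne_zero (by simpa using hp)
  have hpdeg : p.natDegree = 2 := by
    have h := Y.charpoly_natDegree_eq_dim
    rw [hp, Polynomial.natDegree_C_mul hk, Polynomial.natDegree_pow] at h
    simp at h
    omega
  have hpe : p = Polynomial.C (p.coeff 2) * Polynomial.X ^ 2 + Polynomial.C (p.coeff 1) *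
      Polynomial.X + Polynomial.C (p.coeff 0) := by
    conv_lhs => rw [p.as_sum_range_C_mul_X_pow, hpdeg]
    simp [Finset.sum_range_succ]
    ring
  set a := p.coeff 2 with ha'
  set a₁ := p.coeff 1
  set a₀ := p.coeff 0
  have ha : a ≠ 0 := by
    have : p.leadingCoeff ≠ 0 := by
      rw [Polynomial.leadingCoeff_ne_zero]
      rintro rfl
      simp at hpdeg
    rwa [Polynomial.leadingCoeff, hpdeg] at this
  have hexp : Y.charpoly = Polynomial.C (k * a ^ 2) * Polynomial.X ^ 4 +
      Polynomial.C (2 * k * a * a₁) * Polynomial.X ^ 3 +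
      Polynomial.C (k * (a₁ ^ 2 + 2 * a * a₀)) * Polynomial.X ^ 2 +
      Polynomial.C (2 * k * a₁ * a₀) * Polynomial.X + Polynomial.C (k * a₀ ^ 2) := by
    rw [hp, hpe]
    simp only [map_mul, map_add, map_pow, map_ofNat]
    ring
  have h4 : k * a ^ 2 = 1 := by
    have h := Y.charpoly_monic.coeff_natDegree
    rw [Y.charpoly_natDegree_eq_dim, hexp] at h
    simp only [Polynomial.coeff_add, Polynomial.coeff_C_mul, Polynomial.coeff_X_pow,
      Polynomial.coeff_X, Polynomial.coeff_C, Fintype.card_fin] at h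
    norm_num at h
    exact h
  -- The `X ^ 3` coefficient `2 * k * a * a₁` is minus the trace.
  have h3 : a₁ = 0 := by
    have h := Y.trace_eq_neg_charpoly_coeff
    rw [htr, hexp] at h
    simp only [Polynomial.coeff_add, Polynomial.coeff_C_mul, Polynomial.coeff_X_pow,
      Polynomial.coeff_X, Polynomial.coeff_C, Fintype.card_fin] at h
    norm_num [hk, ha] at h
    exact h
  rw [h3] at hpe hexp
  refine ⟨-a₀ / a, ?_, fun t => ?_⟩
  · rw [hpe] at hY
    simp only [map_add, map_mul, Polynomial.aeval_C, Polynomial.aeval_X, map_pow, map_zero,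
      zero_mul, add_zero, Algebra.algebraMap_eq_smul_one, smul_mul_assoc, one_mul] at hY
    rw [← sq]
    have h : a • Y ^ 2 = (-a₀) • (1 : Matrix (Fin 4) (Fin 4) ℂ) := by
      rw [neg_smul]; exact eq_neg_of_add_eq_zero_left hY
    rw [div_eq_inv_mul, mul_smul, ← h, smul_smul, inv_mul_cancel₀ ha, one_smul]
  · have h := Y.eval_charpoly (-t)
    have h' : Matrix.scalar (Fin 4) (-t) - Y = -(t • (1 : Matrix (Fin 4) (Fin 4) ℂ) + Y) := by
      rw [Matrix.smul_one_eq_diagonal]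
      simp [Matrix.scalar_apply, ← Matrix.diagonal_neg, sub_eq_add_neg, add_comm]
    rw [h', Matrix.det_neg, hexp] at h
    simp at h
    have ht : (t ^ 2 - -a₀ / a) ^ 2 = k * (a * t ^ 2 + a₀) ^ 2 := by
      field_simp
      linear_combination (-(t ^ 2 * a + a₀) ^ 2) * h4
    rw [ht]
    linear_combination -h

theorem map_linearFormMatrix {m : ℕ} {E : Submodule ℂ (Matrix (Fin 4) (Fin 4) ℂ)}
    (b : Module.Basis (Fin m) ℂ E) {R : Type*} [CommRing R] [Algebra ℂ R] (g : Fin m → R)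
    (i j : Fin 4) :
    MvPolynomial.aeval g (linearFormMatrix b i j) =
      ∑ k, algebraMap ℂ R ((b k : Matrix (Fin 4) (Fin 4) ℂ) i j) * g k := by
  simp [linearFormMatrix]

theorem coe_eq_sum_repr {m : ℕ} {E : Submodule ℂ (Matrix (Fin 4) (Fin 4) ℂ)}
    (b : Module.Basis (Fin m) ℂ E) (M : E) :
    (M : Matrix (Fin 4) (Fin 4) ℂ) = ∑ k, b.repr M k • (b k : Matrix (Fin 4) (Fin 4) ℂ) := by
  refine (congrArg Subtype.val (b.sum_repr M).symm).trans ?_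
  simp only [Submodule.coe_sum, Submodule.coe_smul]

theorem eval_det_linearFormMatrix {m : ℕ} {E : Submodule ℂ (Matrix (Fin 4) (Fin 4) ℂ)}
    (b : Module.Basis (Fin m) ℂ E) (x : Fin m → ℂ) :
    MvPolynomial.eval x (linearFormMatrix b).det =
      (∑ k, x k • (b k : Matrix (Fin 4) (Fin 4) ℂ)).det := by
  rw [RingHom.map_det]
  congr 1
  ext1 i j
  simp [linearFormMatrix, Matrix.sum_apply, mul_comm]

/-- Relative to an invertible matrix of the space, the traceless part of a nondegenerate space
satisfying the divisibility hypothesis consists of matrices with scalar square. -/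
theorem sq_inv_mul_eq_smul_one {m : ℕ} {E : Submodule ℂ (Matrix (Fin 4) (Fin 4) ℂ)}
    (b : Module.Basis (Fin m) ℂ E) {S : MvPolynomial (Fin m) ℂ} {c : ℂ}
    (hdet : (linearFormMatrix b).det = MvPolynomial.C c * S ^ 2)
    {N : Matrix (Fin 4) (Fin 4) (MvPolynomial (Fin m) ℂ)}
    (hN : N * linearFormMatrix b = (MvPolynomial.C c * S) • (1 : Matrix (Fin 4) (Fin 4) _))
    {M₀ M : Matrix (Fin 4) (Fin 4) ℂ} (hM₀ : M₀ ∈ E) (hM : M ∈ E) (hu : IsUnit M₀.det)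
    (htr : (M₀⁻¹ * M).trace = 0) :
    ∃ d : ℂ, (M₀⁻¹ * M) * (M₀⁻¹ * M) = d • (1 : Matrix (Fin 4) (Fin 4) ℂ) ∧
      ∀ t : ℂ, (t • (1 : Matrix (Fin 4) (Fin 4) ℂ) + M₀⁻¹ * M).det = (t ^ 2 - d) ^ 2 := by
  -- Restriction to the pencil `X * M₀ - M`, which is `M₀` times the characteristic matrix of `M₀⁻¹
  -- * M`.
  set f : MvPolynomial (Fin m) ℂ →ₐ[ℂ] Polynomial ℂ := MvPolynomial.aeval fun k =>
    Polynomial.C (b.repr ⟨M₀, hM₀⟩ k) * Polynomial.X - Polynomial.C (b.repr ⟨M, hM⟩ k) with hf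
  have hc0 : c ≠ 0 := by
    rintro rfl
    have h := eval_det_linearFormMatrix b (b.repr ⟨M₀, hM₀⟩)
    rw [← coe_eq_sum_repr b ⟨M₀, hM₀⟩, hdet] at h
    simp at h
    exact hu.ne_zero h.symm
  set A' := f.toRingHom.mapMatrix (linearFormMatrix b) with hA'
  have hA : A' = M₀.map Polynomial.C * (M₀⁻¹ * M).charmatrix := by
    have h1 : M₀.map Polynomial.C * (M₀⁻¹ * M).charmatrix =
        M₀.map Polynomial.C * Matrix.scalar (Fin 4) Polynomial.X - M.map Polynomial.C := by
      rw [Matrix.charmatrix, mul_sub, RingHom.mapMatrix_apply, ← Matrix.map_mul,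
        ← Matrix.mul_assoc, Matrix.mul_nonsing_inv _ hu, Matrix.one_mul]
    rw [h1]
    ext1 i j
    have hi : M₀ i j = ∑ k, b.repr ⟨M₀, hM₀⟩ k * (b k : Matrix (Fin 4) (Fin 4) ℂ) i j := by
      simpa [Matrix.sum_apply] using congrFun (congrFun (coe_eq_sum_repr b ⟨M₀, hM₀⟩) i) j
    have hj : M i j = ∑ k, b.repr ⟨M, hM⟩ k * (b k : Matrix (Fin 4) (Fin 4) ℂ) i j := by
      simpa [Matrix.sum_apply] using congrFun (congrFun (coe_eq_sum_repr b ⟨M, hM⟩) i) j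
    have hl : A' i j = f (linearFormMatrix b i j) := rfl
    rw [hl, hf, map_linearFormMatrix]
    simp only [Matrix.sub_apply, Matrix.scalar_apply, Matrix.mul_diagonal, Matrix.map_apply]
    rw [hi, hj, map_sum, map_sum, Finset.sum_mul, ← Finset.sum_sub_distrib]
    refine Finset.sum_congr rfl fun k _ => ?_
    rw [Polynomial.algebraMap_eq, map_mul, map_mul]
    ring
  have hdet' : A'.det = Polynomial.C c * f S ^ 2 := by
    rw [hA', ← RingHom.map_det, hdet]
    simp
  have hchar : (M₀⁻¹ * M).charpoly = Polynomial.C (c * M₀.det⁻¹) * f S ^ 2 := by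
    rw [hA, Matrix.det_mul, ← RingHom.mapMatrix_apply, ← RingHom.map_det] at hdet'
    have hm : Polynomial.C (M₀.det⁻¹) * Polynomial.C M₀.det = 1 := by
      rw [← map_mul, inv_mul_cancel₀ hu.ne_zero, map_one]
    rw [map_mul, Matrix.charpoly]
    linear_combination Polynomial.C (M₀.det⁻¹) * hdet' - (M₀⁻¹ * M).charmatrix.det * hm
  refine sq_eq_smul_one_of_charpoly_eq hchar ?_ htr
  have hmul : (f.toRingHom.mapMatrix N * M₀.map Polynomial.C) * (M₀⁻¹ * M).charmatrix =
      (Polynomial.C c * f S) • (1 : Matrix (Fin 4) (Fin 4) (Polynomial ℂ)) := by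
    rw [Matrix.mul_assoc, ← hA, hA', ← map_mul, hN]
    ext1 i j
    by_cases hij : i = j <;> simp [hij]
  have h0 := Matrix.aeval_eq_zero_of_mul_charmatrix hmul
  rw [map_mul, Polynomial.aeval_C, Algebra.algebraMap_eq_smul_one, smul_mul_assoc, one_mul] at h0
  exact (smul_eq_zero.1 h0).resolve_left hc0

/-! ### The quadratic form given by squaring. -/

section ScalarSquares

variable {V : Submodule ℂ (Matrix (Fin 4) (Fin 4) ℂ)}

theorem mul_self_eq_trace_smul_one
    (hV : ∀ v ∈ V, ∃ d : ℂ, v * v = d • (1 : Matrix (Fin 4) (Fin 4) ℂ))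
    {v : Matrix (Fin 4) (Fin 4) ℂ} (hv : v ∈ V) :
    v * v = ((v * v).trace / 4) • (1 : Matrix (Fin 4) (Fin 4) ℂ) := by
  obtain ⟨d, hd⟩ := hV v hv
  rw [hd, Matrix.trace_smul, Matrix.trace_one]
  simp

/-- Polarization of the squaring form: orthogonality for the trace form means anticommutation. -/
theorem mul_add_mul_eq_trace_smul_one
    (hV : ∀ v ∈ V, ∃ d : ℂ, v * v = d • (1 : Matrix (Fin 4) (Fin 4) ℂ))
    {v w : Matrix (Fin 4) (Fin 4) ℂ} (hv : v ∈ V) (hw : w ∈ V) :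
    v * w + w * v = ((v * w).trace / 2) • (1 : Matrix (Fin 4) (Fin 4) ℂ) := by
  have h := mul_self_eq_trace_smul_one hV (V.add_mem hv hw)
  have h1 := mul_self_eq_trace_smul_one hV hv
  have h2 := mul_self_eq_trace_smul_one hV hw
  have he : (v + w) * (v + w) = v * v + (v * w + w * v) + w * w := by noncomm_ring
  have ht : ((v + w) * (v + w)).trace = (v * v).trace + 2 * (v * w).trace + (w * w).trace := by
    rw [he, Matrix.trace_add, Matrix.trace_add, Matrix.trace_add, Matrix.trace_mul_comm w v]
    ring
  have h3 : v * w + w * v = (v + w) * (v + w) - v * v - w * w := by noncomm_ring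
  rw [h3, h, h1, h2, ht, ← sub_smul, ← sub_smul]
  congr 1
  ring

theorem exists_mem_mul_self_eq_one
    (hV : ∀ v ∈ V, ∃ d : ℂ, v * v = d • (1 : Matrix (Fin 4) (Fin 4) ℂ))
    {v : Matrix (Fin 4) (Fin 4) ℂ} (hv : v ∈ V) (h0 : v * v ≠ 0) :
    ∃ s : ℂ, (s • v) * (s • v) = 1 := by
  obtain ⟨d, hd⟩ := hV v hv
  have hd0 : d ≠ 0 := by
    rintro rfl
    exact h0 (by rw [hd, zero_smul])
  obtain ⟨s, hs⟩ := IsAlgClosed.exists_pow_nat_eq d⁻¹ zero_lt_two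
  refine ⟨s, ?_⟩
  rw [smul_mul_smul_comm, hd, smul_smul, ← sq, hs, inv_mul_cancel₀ hd0, one_smul]

/-- In a space of matrices with scalar squares, either squaring is the square of a linear form, or
there are two anticommuting involutions. -/
theorem mul_self_eq_sq_or_exists_anticommuting
    (hV : ∀ v ∈ V, ∃ d : ℂ, v * v = d • (1 : Matrix (Fin 4) (Fin 4) ℂ)) :
    (∃ Z : Matrix (Fin 4) (Fin 4) ℂ, ∀ v ∈ V,
      v * v = (v * Z).trace ^ 2 • (1 : Matrix (Fin 4) (Fin 4) ℂ)) ∨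
    ∃ e₁ ∈ V, ∃ e₂ ∈ V, e₁ * e₁ = 1 ∧ e₂ * e₂ = 1 ∧ e₁ * e₂ = -(e₂ * e₁) := by
  by_cases hz : ∀ v ∈ V, v * v = 0
  · exact Or.inl ⟨0, fun v hv => by simp [hz v hv]⟩
  push Not at hz
  obtain ⟨v₁, hv₁, hz₁⟩ := hz
  obtain ⟨s, hs⟩ := exists_mem_mul_self_eq_one hV hv₁ hz₁
  have he₁ : s • v₁ ∈ V := V.smul_mem s hv₁
  generalize s • v₁ = e₁ at hs he₁
  by_cases hp : ∀ w ∈ V, (w * e₁).trace = 0 → w * w = 0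
  · left
    -- Since `e₁ * e₁ = 1` has trace 4, the component of `v` along `e₁` is `(v * e₁).trace / 4`; the
    -- rest squares to zero by `hp`.
    refine ⟨(4⁻¹ : ℂ) • e₁, fun v hv => ?_⟩
    have hw := hp (v - ((v * e₁).trace / 4) • e₁) (V.sub_mem hv (V.smul_mem _ he₁)) (by
      simp [sub_mul, hs])
    have hc := mul_add_mul_eq_trace_smul_one hV hv he₁
    have hexp : (v - ((v * e₁).trace / 4) • e₁) * (v - ((v * e₁).trace / 4) • e₁) =
        v * v - ((v * e₁).trace / 4) • (v * e₁ + e₁ * v) +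
          (((v * e₁).trace / 4) * ((v * e₁).trace / 4)) • (e₁ * e₁) := by
      simp only [sub_mul, mul_sub, smul_mul_assoc, mul_smul_comm, smul_add, smul_sub, smul_smul]
      abel
    rw [hexp, hc, hs, smul_smul, sub_add, ← sub_smul, sub_eq_zero] at hw
    rw [hw]
    congr 1
    simp
    ring
  · push Not at hp
    obtain ⟨w, hw, hwe, hw0⟩ := hp
    obtain ⟨t, ht⟩ := exists_mem_mul_self_eq_one hV hw hw0
    refine Or.inr ⟨e₁, he₁, t • w, V.smul_mem t hw, hs, ht, ?_⟩
    have hc := mul_add_mul_eq_trace_smul_one hV hw he₁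
    rw [hwe, zero_div, zero_smul] at hc
    rw [mul_smul_comm, smul_mul_assoc, ← smul_neg, eq_neg_of_add_eq_zero_right hc]

end ScalarSquares

/-! ### Normal form of anticommuting involutions. -/

/-- The block diagonal matrix of two copies of `diag(1, -1)`. -/
def pauliZ : Matrix (Fin 4) (Fin 4) ℂ :=
  !![1, 0, 0, 0; 0, -1, 0, 0; 0, 0, 1, 0; 0, 0, 0, -1]

/-- The block diagonal matrix of two copies of the `2 × 2` exchange matrix. -/
def pauliX : Matrix (Fin 4) (Fin 4) ℂ :=
  !![0, 1, 0, 0; 1, 0, 0, 0; 0, 0, 0, 1; 0, 0, 1, 0]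

/-- Up to conjugation, two anticommuting involutions of `ℂ⁴` are `pauliZ` and `pauliX`. -/
theorem exists_conj_pauli {e₁ e₂ : Matrix (Fin 4) (Fin 4) ℂ} (h₁ : e₁ * e₁ = 1)
    (h₂ : e₂ * e₂ = 1) (h : e₁ * e₂ = -(e₂ * e₁)) :
    ∃ P : Matrix (Fin 4) (Fin 4) ℂ, IsUnit P.det ∧ e₁ * P = P * pauliZ ∧ e₂ * P = P * pauliX := by
  have a₁ : ∀ v : Fin 4 → ℂ, e₁.mulVec (e₁.mulVec v) = v := fun v => by
    rw [Matrix.mulVec_mulVec, h₁, Matrix.one_mulVec]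
  have a₂ : ∀ v : Fin 4 → ℂ, e₂.mulVec (e₂.mulVec v) = v := fun v => by
    rw [Matrix.mulVec_mulVec, h₂, Matrix.one_mulVec]
  have a₃ : ∀ v : Fin 4 → ℂ, e₁.mulVec (e₂.mulVec v) = -e₂.mulVec (e₁.mulVec v) := fun v => by
    rw [Matrix.mulVec_mulVec, h, Matrix.neg_mulVec, Matrix.mulVec_mulVec]
  -- `e₂` swaps the eigenspaces of `e₁`, so if the `+1` eigenspace lay on the line of `u₁`, then
  -- `u₁` and `e₂ u₁` would span `ℂ⁴`.
  have hspan : ∀ u₁ : Fin 4 → ℂ, ∃ u, e₁.mulVec u = u ∧ ∀ c : ℂ, u ≠ c • u₁ := fun u₁ => by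
    by_contra! hcon
    have htop : (⊤ : Submodule ℂ (Fin 4 → ℂ)) ≤ Submodule.span ℂ {u₁, e₂.mulVec u₁} := by
      rintro v -
      obtain ⟨c, hc⟩ := hcon (v + e₁.mulVec v) (by rw [Matrix.mulVec_add, a₁, add_comm])
      obtain ⟨d, hd⟩ := hcon (e₂.mulVec (v - e₁.mulVec v)) (by
        rw [a₃, ← Matrix.mulVec_neg, Matrix.mulVec_sub, a₁, neg_sub])
      have hd' := congrArg e₂.mulVec hd
      rw [a₂, Matrix.mulVec_smul] at hd'
      refine Submodule.mem_span_pair.2 ⟨c / 2, d / 2, ?_⟩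
      have : v = (2⁻¹ : ℂ) • ((v + e₁.mulVec v) + (v - e₁.mulVec v)) := by
        rw [add_add_sub_cancel, ← two_smul ℂ v, smul_smul]; norm_num
      rw [this, hc, hd', smul_add, smul_smul, smul_smul]
      congr 2 <;> ring
    have hle := Submodule.finrank_mono htop
    have hfin : Module.finrank ℂ (Submodule.span ℂ {u₁, e₂.mulVec u₁}) ≤ 2 := by
      refine (finrank_span_le_card (R := ℂ) ({u₁, e₂.mulVec u₁} : Set (Fin 4 → ℂ))).trans ?_
      rw [Set.toFinset_card, ← Nat.card_eq_fintype_card]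
      exact (Set.ncard_insert_le _ _).trans (by rw [Set.ncard_singleton])
    rw [finrank_top, Module.finrank_fin_fun] at hle
    omega
  obtain ⟨u₁, hu₁, hn₁⟩ := hspan 0
  obtain ⟨u₂, hu₂, hn₂⟩ := hspan u₁
  have hind : ∀ a c : ℂ, a • u₁ + c • u₂ = 0 → a = 0 ∧ c = 0 := fun a c hac => by
    have hc : c = 0 := by
      by_contra hc
      refine hn₂ (-(c⁻¹ * a)) ?_
      have : c • u₂ = -(a • u₁) := eq_neg_of_add_eq_zero_right hac
      rw [neg_smul, mul_smul, ← smul_neg, ← this, smul_smul, inv_mul_cancel₀ hc, one_smul]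
    refine ⟨?_, hc⟩
    rw [hc, zero_smul, add_zero] at hac
    exact (smul_eq_zero.1 hac).resolve_right fun hu => hn₁ 0 (by simp [hu])
  have hv₁ : e₁.mulVec (e₂.mulVec u₁) = -e₂.mulVec u₁ := by rw [a₃, hu₁]
  have hv₂ : e₁.mulVec (e₂.mulVec u₂) = -e₂.mulVec u₂ := by rw [a₃, hu₂]
  set P : Matrix (Fin 4) (Fin 4) ℂ :=
    (Matrix.of ![u₁, e₂.mulVec u₁, u₂, e₂.mulVec u₂]).transpose with hP
  have hcol : ∀ (e : Matrix (Fin 4) (Fin 4) ℂ) (i j : Fin 4),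
      (e * P) i j = e.mulVec (![u₁, e₂.mulVec u₁, u₂, e₂.mulVec u₂] j) i := fun e i j => rfl
  refine ⟨P, ?_, ?_, ?_⟩
  · rw [isUnit_iff_ne_zero]
    intro h0
    obtain ⟨x, hx0, hx⟩ := Matrix.exists_mulVec_eq_zero_iff.2 h0
    have hx' : x 0 • u₁ + x 1 • e₂.mulVec u₁ + x 2 • u₂ + x 3 • e₂.mulVec u₂ = 0 := by
      rw [← hx]
      ext i
      simp [hP, Matrix.mulVec, dotProduct, Fin.sum_univ_four, mul_comm]
    -- Adding this to `hx'` isolates the `+1` eigenspace part of the relation.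
    have hx'' := congrArg e₁.mulVec hx'
    simp only [Matrix.mulVec_add, Matrix.mulVec_smul, hu₁, hu₂, hv₁, hv₂,
      Matrix.mulVec_zero, smul_neg] at hx''
    have hp : x 0 • u₁ + x 2 • u₂ = 0 := by
      have : (2 : ℂ) • (x 0 • u₁ + x 2 • u₂) = 0 := by
        rw [two_smul]
        linear_combination hx' + hx''
      exact (smul_eq_zero.1 this).resolve_left two_ne_zero
    have hm : x 1 • u₁ + x 3 • u₂ = 0 := by
      have : x 1 • e₂.mulVec u₁ + x 3 • e₂.mulVec u₂ = 0 := by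
        linear_combination hx' - hp
      have := congrArg e₂.mulVec this
      simpa [Matrix.mulVec_add, Matrix.mulVec_smul, a₂] using this
    obtain ⟨h0, h2⟩ := hind _ _ hp
    obtain ⟨h1, h3⟩ := hind _ _ hm
    refine hx0 (funext fun i => ?_)
    fin_cases i <;> simpa
  · ext i j
    rw [hcol]
    fin_cases j <;>
      simp [pauliZ, Matrix.mul_apply, Fin.sum_univ_four, hP, hu₁, hu₂, hv₁, hv₂,
        -Matrix.mulVec_mulVec]
  · ext i j
    rw [hcol]
    fin_cases j <;>
      simp [pauliX, Matrix.mul_apply, Fin.sum_univ_four, hP, a₂, -Matrix.mulVec_mulVec]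

/-- The general matrix anticommuting with `pauliZ` and `pauliX`. -/
def pauliYBlock (a b c d : ℂ) : Matrix (Fin 4) (Fin 4) ℂ :=
  !![0, a, 0, b; -a, 0, -b, 0; 0, c, 0, d; -c, 0, -d, 0]

theorem eq_pauliYBlock_of_anticommute {W : Matrix (Fin 4) (Fin 4) ℂ}
    (hZ : W * pauliZ + pauliZ * W = 0) (hX : W * pauliX + pauliX * W = 0) :
    W = pauliYBlock (W 0 1) (W 0 3) (W 2 1) (W 2 3) := by
  have z : ∀ i j, (W * pauliZ) i j + (pauliZ * W) i j = 0 := fun i j => by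
    rw [← Matrix.add_apply, hZ]; rfl
  have x : ∀ i j, (W * pauliX) i j + (pauliX * W) i j = 0 := fun i j => by
    rw [← Matrix.add_apply, hX]; rfl
  simp only [Matrix.mul_apply, Fin.sum_univ_four] at z x
  have z00 := z 0 0
  have z02 := z 0 2
  have z20 := z 2 0
  have z22 := z 2 2
  have z11 := z 1 1
  have z13 := z 1 3
  have z31 := z 3 1
  have z33 := z 3 3
  have x00 := x 0 0
  have x02 := x 0 2
  have x20 := x 2 0
  have x22 := x 2 2
  simp [pauliZ] at z00 z02 z20 z22 z11 z13 z31 z33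
  simp [pauliX] at x00 x02 x20 x22
  ext i j
  fin_cases i <;> fin_cases j <;> simp [pauliYBlock] <;> grind

/-- With `K = !![a, b; c, d]` the block is `K ⊗ ε`, whose square is `-K ^ 2 ⊗ 1`; the equations say
that `K ^ 2` is scalar. -/
theorem pauliYBlock_mul_self {a b c d e : ℂ}
    (h : pauliYBlock a b c d * pauliYBlock a b c d = e • (1 : Matrix (Fin 4) (Fin 4) ℂ)) :
    b * (a + d) = 0 ∧ c * (a + d) = 0 ∧ (a - d) * (a + d) = 0 := by
  have x : ∀ i j, (pauliYBlock a b c d * pauliYBlock a b c d) i j =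
    (e • (1 : Matrix (Fin 4) (Fin 4) ℂ)) i j := fun i j => by rw [h]
  have h00 := x 0 0
  have h22 := x 2 2
  have h02 := x 0 2
  have h20 := x 2 0
  simp [pauliYBlock, Matrix.mul_apply, Fin.sum_univ_four] at h00 h22 h02 h20
  refine ⟨?_, ?_, ?_⟩
  · linear_combination -h02
  · linear_combination -h20
  · linear_combination h22 - h00

/-- The symplectic matrix with blocks `0, 1, -1, 0`. -/
def symplecticForm : Matrix (Fin 4) (Fin 4) ℂ :=
  !![0, 0, 1, 0; 0, 0, 0, 1; -1, 0, 0, 0; 0, -1, 0, 0]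

theorem symplecticForm_mul_self : symplecticForm * -symplecticForm = 1 := by
  ext i j
  fin_cases i <;> fin_cases j <;> simp [symplecticForm, Matrix.mul_apply, Fin.sum_univ_four]

/-! ### Spaces containing the identity and both Pauli blocks. -/

section PauliSpace

variable {F : Submodule ℂ (Matrix (Fin 4) (Fin 4) ℂ)}

/-- Orthogonal projection for the trace form: the remainder is orthogonal to `pauliZ` and `pauliX`,
so it anticommutes with both. -/
theorem exists_eq_add_pauliYBlock (h1 : 1 ∈ F) (hZ : pauliZ ∈ F) (hX : pauliX ∈ F)
    (hF : ∀ Y ∈ F, Y.trace = 0 → ∃ d : ℂ, Y * Y = d • (1 : Matrix (Fin 4) (Fin 4) ℂ))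
    {Y : Matrix (Fin 4) (Fin 4) ℂ} (hY : Y ∈ F) :
    ∃ t r s a b c d : ℂ, pauliYBlock a b c d ∈ F ∧
      Y = t • (1 : Matrix (Fin 4) (Fin 4) ℂ) + r • pauliZ + s • pauliX + pauliYBlock a b c d := by
  set V := F ⊓ LinearMap.ker (Matrix.traceLinearMap (Fin 4) ℂ ℂ) with hVdef
  have hV : ∀ v ∈ V, ∃ d : ℂ, v * v = d • (1 : Matrix (Fin 4) (Fin 4) ℂ) := fun v hv =>
    hF v hv.1 hv.2
  have hZV : pauliZ ∈ V := ⟨hZ, by simp [pauliZ, Matrix.trace, Fin.sum_univ_four]⟩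
  have hXV : pauliX ∈ V := ⟨hX, by simp [pauliX, Matrix.trace, Fin.sum_univ_four]⟩
  have hZZ : (pauliZ * pauliZ).trace = 4 := by
    simp [pauliZ, Matrix.trace, Fin.sum_univ_four]; norm_num
  have hXX : (pauliX * pauliX).trace = 4 := by
    simp [pauliX, Matrix.trace, Fin.sum_univ_four]; norm_num
  have hXZ : (pauliX * pauliZ).trace = 0 := by
    simp [pauliX, pauliZ, Matrix.trace, Fin.sum_univ_four]
  have hZX : (pauliZ * pauliX).trace = 0 := by rw [Matrix.trace_mul_comm, hXZ]
  set Y₀ := Y - (Y.trace / 4) • (1 : Matrix (Fin 4) (Fin 4) ℂ) with hY₀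
  have hY₀V : Y₀ ∈ V := ⟨F.sub_mem hY (F.smul_mem _ h1), by simp [hY₀]⟩
  set W := Y₀ - ((Y₀ * pauliZ).trace / 4) • pauliZ - ((Y₀ * pauliX).trace / 4) • pauliX with hW
  have hWV : W ∈ V := V.sub_mem (V.sub_mem hY₀V (V.smul_mem _ hZV)) (V.smul_mem _ hXV)
  have hWZ : (W * pauliZ).trace = 0 := by
    simp only [hW, sub_mul, smul_mul_assoc, Matrix.trace_sub, Matrix.trace_smul, hZZ, hXZ,
      smul_eq_mul]
    ring
  have hWX : (W * pauliX).trace = 0 := by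
    simp only [hW, sub_mul, smul_mul_assoc, Matrix.trace_sub, Matrix.trace_smul, hXX, hZX,
      smul_eq_mul]
    ring
  have hWe := eq_pauliYBlock_of_anticommute
    (by rw [mul_add_mul_eq_trace_smul_one hV hWV hZV, hWZ, zero_div, zero_smul])
    (by rw [mul_add_mul_eq_trace_smul_one hV hWV hXV, hWX, zero_div, zero_smul])
  refine ⟨Y.trace / 4, (Y₀ * pauliZ).trace / 4, (Y₀ * pauliX).trace / 4, W 0 1, W 0 3, W 2 1,
    W 2 3, hWe ▸ hWV.1, ?_⟩
  rw [← hWe, hW, hY₀]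
  abel

/-- `symplecticForm` is `ε ⊗ 1`. It takes `1 ⊗ X` with `X` symmetric to a skew matrix, and `K ⊗ ε`
to `ε K ⊗ ε`, which is skew exactly when `K` is traceless. -/
theorem symplecticForm_mul_or_eq_diagGeneralSpace (h1 : 1 ∈ F) (hZ : pauliZ ∈ F)
    (hX : pauliX ∈ F)
    (hF : ∀ Y ∈ F, Y.trace = 0 → ∃ d : ℂ, Y * Y = d • (1 : Matrix (Fin 4) (Fin 4) ℂ)) :
    (∀ Y ∈ F, (symplecticForm * Y).transpose = -(symplecticForm * Y)) ∨ F = diagGeneralSpace := by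
  have htr : ∀ a b c d, (pauliYBlock a b c d).trace = 0 := fun a b c d => by
    simp [pauliYBlock, Matrix.trace, Fin.sum_univ_four]
  have hsq : ∀ a b c d, pauliYBlock a b c d ∈ F →
      b * (a + d) = 0 ∧ c * (a + d) = 0 ∧ (a - d) * (a + d) = 0 := fun a b c d h => by
    obtain ⟨e, he⟩ := hF _ h (htr a b c d)
    exact pauliYBlock_mul_self he
  by_cases hs : ∀ a b c d, pauliYBlock a b c d ∈ F → a + d = 0
  · left
    intro Y hY
    obtain ⟨t, r, s, a, b, c, d, hm, rfl⟩ := exists_eq_add_pauliYBlock h1 hZ hX hF hY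
    have had : d = -a := by linear_combination hs a b c d hm
    subst had
    ext i j
    simp only [Matrix.transpose_apply, Matrix.neg_apply]
    fin_cases i <;> fin_cases j <;>
      simp [symplecticForm, pauliYBlock, pauliZ, pauliX, Matrix.mul_apply, Fin.sum_univ_four]
  · right
    push Not at hs
    obtain ⟨a, b, c, d, hm, had⟩ := hs
    obtain ⟨hb, hc, hd⟩ := hsq a b c d hm
    have hb : b = 0 := (mul_eq_zero.1 hb).resolve_right had
    have hc : c = 0 := (mul_eq_zero.1 hc).resolve_right had
    have hd : d = a := (sub_eq_zero.1 ((mul_eq_zero.1 hd).resolve_right had)).symm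
    subst hb hc hd
    have hd0 : d ≠ 0 := by
      rintro rfl
      simp at had
    have hsm : ∀ z : ℂ, pauliYBlock z 0 0 z ∈ F := fun z => by
      have h := F.smul_mem (z / d) hm
      have he : (z / d) • pauliYBlock d 0 0 d = pauliYBlock z 0 0 z := by
        ext i j
        fin_cases i <;> fin_cases j <;> simp [pauliYBlock, hd0]
      rwa [he] at h
    apply le_antisymm
    · intro Y hY
      obtain ⟨t, r, s, a', b', c', d', hm', rfl⟩ := exists_eq_add_pauliYBlock h1 hZ hX hF hY
      obtain ⟨hb, hc, hd⟩ := hsq a' b' c' d' hm'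
      -- Adding the identity to `K` raises its trace by 2, so subtracting the two sets of equations
      -- forces `K` to be scalar.
      have hadd : pauliYBlock (a' + 1) b' c' (d' + 1) ∈ F := by
        have h := F.add_mem hm' (hsm 1)
        have he : pauliYBlock a' b' c' d' + pauliYBlock 1 0 0 1 =
            pauliYBlock (a' + 1) b' c' (d' + 1) := by
          ext i j
          fin_cases i <;> fin_cases j <;> simp [pauliYBlock] <;> ring
        rwa [he] at h
      obtain ⟨hb2, hc2, hd2⟩ := hsq _ _ _ _ hadd
      have hb : b' = 0 := by linear_combination (hb2 - hb) / 2
      have hc : c' = 0 := by linear_combination (hc2 - hc) / 2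
      have hd : d' = a' := by linear_combination (hd - hd2) / 2
      subst hb hc hd
      refine ⟨t + r, s + d', s - d', t - r, ?_⟩
      ext i j
      fin_cases i <;> fin_cases j <;> simp [pauliYBlock, pauliZ, pauliX] <;> ring
    · rintro _ ⟨x₁, x₂, x₃, x₄, rfl⟩
      have h := F.add_mem (F.add_mem (F.add_mem (F.smul_mem ((x₁ + x₄) / 2) h1)
        (F.smul_mem ((x₁ - x₄) / 2) hZ)) (F.smul_mem ((x₂ + x₃) / 2) hX)) (hsm ((x₂ - x₃) / 2))
      convert h using 1
      ext i j
      fin_cases i <;> fin_cases j <;> simp [pauliYBlock, pauliZ, pauliX] <;> ring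

end PauliSpace

/-! ### Factorization and rank of the quadric. -/

section Quadric

variable {m : ℕ} {E : Submodule ℂ (Matrix (Fin 4) (Fin 4) ℂ)} (b : Module.Basis (Fin m) ℂ E)
  {S : MvPolynomial (Fin m) ℂ}

/-- A linear functional on the space, as a linear form in the coordinates. -/
noncomputable def linearForm (φ : E →ₗ[ℂ] ℂ) : MvPolynomial (Fin m) ℂ :=
  ∑ k, MvPolynomial.C (φ (b k)) * MvPolynomial.X k

theorem eval_linearForm (φ : E →ₗ[ℂ] ℂ) (x : Fin m → ℂ) :
    MvPolynomial.eval x (linearForm b φ) = φ (∑ k, x k • b k) := by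
  simp [linearForm, mul_comm]

theorem totalDegree_linearForm_le (φ : E →ₗ[ℂ] ℂ) : (linearForm b φ).totalDegree ≤ 1 := by
  refine MvPolynomial.totalDegree_finsetSum_le fun k _ => ?_
  refine (MvPolynomial.totalDegree_mul _ _).trans ?_
  simp

theorem pderiv_linearForm (φ : E →ₗ[ℂ] ℂ) (i : Fin m) :
    MvPolynomial.pderiv i (linearForm b φ) = MvPolynomial.C (φ (b i)) := by
  simp [linearForm, Derivation.leibniz, MvPolynomial.pderiv_X, Pi.single_apply]

theorem det_linearFormMatrix_eq {k : ℂ} {D : MvPolynomial (Fin m) ℂ}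
    (h : ∀ x : Fin m → ℂ, ((∑ k, x k • b k : E) : Matrix (Fin 4) (Fin 4) ℂ).det =
      k * MvPolynomial.eval x D ^ 2) :
    (linearFormMatrix b).det = MvPolynomial.C k * D ^ 2 := by
  refine MvPolynomial.funext fun x => ?_
  rw [eval_det_linearFormMatrix]
  have hs : ((∑ k, x k • b k : E) : Matrix (Fin 4) (Fin 4) ℂ) =
      ∑ k, x k • (b k : Matrix (Fin 4) (Fin 4) ℂ) := by
    simp only [Submodule.coe_sum, Submodule.coe_smul]
  rw [← hs, h]
  simp

/-- `S` is prime, so it would divide a nonzero linear form, which its degree forbids. -/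
theorem det_ne_mul_sq_of_irreducible (hirr : Irreducible S) (hdeg : S.totalDegree = 2) {c : ℂ}
    (hdet : (linearFormMatrix b).det = MvPolynomial.C c * S ^ 2)
    (hdet0 : (linearFormMatrix b).det ≠ 0) (k : ℂ) (φ ψ : E →ₗ[ℂ] ℂ)
    (h : ∀ M : E, (M : Matrix (Fin 4) (Fin 4) ℂ).det = k * (φ M * ψ M) ^ 2) : False := by
  have hfac : (linearFormMatrix b).det =
      MvPolynomial.C k * (linearForm b φ * linearForm b ψ) ^ 2 := by
    refine det_linearFormMatrix_eq b fun x => ?_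
    rw [h, map_mul, eval_linearForm, eval_linearForm]
  have hk : k ≠ 0 := by
    rintro rfl
    exact hdet0 (by rw [hfac]; simp)
  have hne : linearForm b φ * linearForm b ψ ≠ 0 := fun h0 => hdet0 (by rw [hfac, h0]; simp)
  have hdvd : S ∣ (linearForm b φ * linearForm b ψ) ^ 2 := by
    refine ⟨MvPolynomial.C k⁻¹ * (MvPolynomial.C c * S), ?_⟩
    have hkk : (MvPolynomial.C k⁻¹ * MvPolynomial.C k : MvPolynomial (Fin m) ℂ) = 1 := by
      rw [← map_mul, inv_mul_cancel₀ hk, map_one]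
    rw [hfac] at hdet
    linear_combination MvPolynomial.C k⁻¹ * hdet - (linearForm b φ * linearForm b ψ) ^ 2 * hkk
  have hlt : ∀ χ : E →ₗ[ℂ] ℂ, linearForm b χ ≠ 0 → ¬ S ∣ linearForm b χ := by
    rintro χ h0 ⟨T, hT⟩
    have hT0 : T ≠ 0 := by
      rintro rfl
      exact h0 (by simpa using hT)
    have hle := totalDegree_linearForm_le b χ
    rw [hT, MvPolynomial.totalDegree_mul_of_isDomain hirr.ne_zero hT0, hdeg] at hle
    omega
  rcases hirr.prime.dvd_or_dvd (hirr.prime.dvd_of_dvd_pow hdvd) with hd | hd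
  · exact hlt _ (left_ne_zero_of_mul hne) hd
  · exact hlt _ (right_ne_zero_of_mul hne) hd

/-- Comparing square roots of the determinant, `S` is a nonzero multiple of `y₀ y₃ - y₁ y₂` in the
coordinates given by `φ`, a nondegenerate form. -/
theorem quadricRank_eq_four {c : ℂ} (hc : c ≠ 0)
    (hdet : (linearFormMatrix b).det = MvPolynomial.C c * S ^ 2) {k : ℂ} (hk : k ≠ 0)
    (φ : E ≃ₗ[ℂ] (Fin 4 → ℂ))
    (h : ∀ M : E, (M : Matrix (Fin 4) (Fin 4) ℂ).det =
      k * (φ M 0 * φ M 3 - φ M 1 * φ M 2) ^ 2) : quadricRank S = 4 := by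
  obtain rfl : m = 4 := by
    have h1 := Module.finrank_eq_card_basis b
    rw [φ.finrank_eq, Module.finrank_fin_fun, Fintype.card_fin] at h1
    exact h1.symm
  set ℓ : Fin 4 → E →ₗ[ℂ] ℂ := fun i => LinearMap.proj i ∘ₗ φ.toLinearMap with hℓ
  set D := linearForm b (ℓ 0) * linearForm b (ℓ 3) - linearForm b (ℓ 1) * linearForm b (ℓ 2)
    with hD
  have hfac : (linearFormMatrix b).det = MvPolynomial.C k * D ^ 2 := by
    refine det_linearFormMatrix_eq b fun x => ?_
    rw [h, hD]
    simp only [map_sub, map_mul, eval_linearForm]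
    rfl
  obtain ⟨μ, hμ⟩ := IsAlgClosed.exists_pow_nat_eq (k / c) zero_lt_two
  obtain ⟨ν, hν0, hν⟩ : ∃ ν : ℂ, ν ≠ 0 ∧ S = MvPolynomial.C ν * D := by
    have hμ0 : μ ≠ 0 := by
      rintro rfl
      exact div_ne_zero hk hc (by rw [← hμ]; simp)
    have hsq : S ^ 2 = (MvPolynomial.C μ * D) ^ 2 := by
      have hC : (MvPolynomial.C c : MvPolynomial (Fin 4) ℂ) ≠ 0 := by simpa using hc
      refine mul_left_cancel₀ hC ?_
      rw [← hdet, hfac, mul_pow, ← map_pow, hμ, ← mul_assoc, ← map_mul, mul_div_cancel₀ _ hc]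
    rcases sq_eq_sq_iff_eq_or_eq_neg.1 hsq with h | h
    · exact ⟨μ, hμ0, h⟩
    · exact ⟨-μ, neg_ne_zero.2 hμ0, by rw [h, map_neg, neg_mul]⟩
  set L : Matrix (Fin 4) (Fin 4) ℂ := (Pi.basisFun ℂ (Fin 4)).toMatrix (b.map φ) with hL
  have hLu : IsUnit L.det := by
    rw [← Module.Basis.det_apply]
    exact Module.Basis.isUnit_det _ _
  have hLe : ∀ i j, L i j = ℓ i (b j) := fun i j => by simp [hL, hℓ, Module.Basis.toMatrix_apply]
  -- The Hessian of `ν * (y₀ y₃ - y₁ y₂)`; that of `S` is congruent to it through the change of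
  -- coordinates `L`.
  set G : Matrix (Fin 4) (Fin 4) ℂ := !![0, 0, 0, ν; 0, 0, -ν, 0; 0, -ν, 0, 0; ν, 0, 0, 0] with hG
  have hGu : IsUnit G.det := by
    rw [isUnit_iff_ne_zero]
    have : G.det = ν ^ 4 := by
      simp [hG, Matrix.det_succ_row_zero, Fin.sum_univ_succ, Fin.succAbove]
      ring
    rw [this]
    exact pow_ne_zero _ hν0
  have hH : (Matrix.of fun i j : Fin 4 => MvPolynomial.constantCoeff
      (MvPolynomial.pderiv i (MvPolynomial.pderiv j S))) = L.transpose * G * L := by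
    ext i j
    have hlhs : MvPolynomial.constantCoeff (MvPolynomial.pderiv i (MvPolynomial.pderiv j S)) =
        ν * (ℓ 0 (b j) * ℓ 3 (b i) + ℓ 0 (b i) * ℓ 3 (b j) -
          ℓ 1 (b j) * ℓ 2 (b i) - ℓ 1 (b i) * ℓ 2 (b j)) := by
      simp only [hν, hD, Derivation.leibniz, MvPolynomial.pderiv_C, pderiv_linearForm, map_sub,
        map_add, smul_eq_mul, map_mul, MvPolynomial.constantCoeff_C, mul_zero, add_zero]
      ring
    rw [Matrix.of_apply, hlhs]
    simp only [Matrix.mul_apply, Fin.sum_univ_four, Matrix.transpose_apply, hLe]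
    simp [hG]
    ring
  have hu : IsUnit (L.transpose * G * L) := by
    rw [Matrix.isUnit_iff_isUnit_det, Matrix.det_mul, Matrix.det_mul, Matrix.det_transpose]
    exact (hLu.mul hGu).mul hLu
  rw [quadricRank, hH, Matrix.rank_of_isUnit _ hu, Fintype.card_fin]

theorem quadricRank_eq_four_of_map_eq {c : ℂ} (hc : c ≠ 0)
    (hdet : (linearFormMatrix b).det = MvPolynomial.C c * S ^ 2)
    {P Q : Matrix (Fin 4) (Fin 4) ℂ} (hP : IsUnit P.det) (hQ : IsUnit Q.det)
    (hE : E.map (LinearMap.mulLeft ℂ P ∘ₗ LinearMap.mulRight ℂ Q) = diagGeneralSpace) :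
    quadricRank S = 4 := by
  have hmem : ∀ M : E, P * (M * Q) ∈ diagGeneralSpace := fun M => by
    rw [← hE]
    exact ⟨M, M.2, rfl⟩
  set φ : E →ₗ[ℂ] (Fin 4 → ℂ) := LinearMap.pi fun i =>
    Matrix.entryLinearMap ℂ ℂ (![0, 0, 1, 1] i) (![0, 1, 0, 1] i) ∘ₗ
      (LinearMap.mulLeft ℂ P ∘ₗ LinearMap.mulRight ℂ Q) ∘ₗ E.subtype with hφ
  have h0 : ∀ M, φ M 0 = (P * (M * Q)) 0 0 := fun M => rfl
  have h1 : ∀ M, φ M 1 = (P * (M * Q)) 0 1 := fun M => rfl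
  have h2 : ∀ M, φ M 2 = (P * (M * Q)) 1 0 := fun M => rfl
  have h3 : ∀ M, φ M 3 = (P * (M * Q)) 1 1 := fun M => rfl
  have hinj : Function.Injective φ := by
    rw [injective_iff_map_eq_zero]
    intro M hM
    obtain ⟨x₁, x₂, x₃, x₄, hx⟩ := hmem M
    have e0 := h0 M
    have e1 := h1 M
    have e2 := h2 M
    have e3 := h3 M
    rw [hM, hx] at e0 e1 e2 e3
    simp at e0 e1 e2 e3
    rw [← e0, ← e1, ← e2, ← e3] at hx
    have hz : P * ((M : Matrix (Fin 4) (Fin 4) ℂ) * Q) = 0 := by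
      rw [hx]
      ext i j
      fin_cases i <;> fin_cases j <;> rfl
    have hM0 : (M : Matrix (Fin 4) (Fin 4) ℂ) = P⁻¹ * (P * (M * Q)) * Q⁻¹ := by
      rw [← Matrix.mul_assoc, Matrix.nonsing_inv_mul _ hP, Matrix.one_mul, Matrix.mul_assoc,
        Matrix.mul_nonsing_inv _ hQ, Matrix.mul_one]
    rw [hz, Matrix.mul_zero, Matrix.zero_mul] at hM0
    exact Subtype.ext hM0
  have hsurj : Function.Surjective φ := by
    intro x
    have hx : (!![x 0, x 1, 0, 0; x 2, x 3, 0, 0; 0, 0, x 0, x 1; 0, 0, x 2, x 3] :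
        Matrix (Fin 4) (Fin 4) ℂ) ∈ diagGeneralSpace := ⟨_, _, _, _, rfl⟩
    rw [← hE] at hx
    obtain ⟨M, hM, hMx⟩ := hx
    have hMx : P * (M * Q) = _ := hMx
    refine ⟨⟨M, hM⟩, funext fun i => ?_⟩
    fin_cases i
    · exact (h0 _).trans (by rw [hMx]; rfl)
    · exact (h1 _).trans (by rw [hMx]; rfl)
    · exact (h2 _).trans (by rw [hMx]; rfl)
    · exact (h3 _).trans (by rw [hMx]; rfl)
  have hbij : Function.Bijective φ := ⟨hinj, hsurj⟩
  refine quadricRank_eq_four b hc hdet (k := (P.det * Q.det)⁻¹)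
    (inv_ne_zero (mul_ne_zero hP.ne_zero hQ.ne_zero)) (LinearEquiv.ofBijective φ hbij)
    fun M => ?_
  have hval : LinearEquiv.ofBijective φ hbij M = φ M := rfl
  rw [hval, h0, h1, h2, h3]
  obtain ⟨x₁, x₂, x₃, x₄, hx⟩ := hmem M
  have hd : P.det * Q.det * (M : Matrix (Fin 4) (Fin 4) ℂ).det =
      (x₁ * x₄ - x₂ * x₃) ^ 2 := by
    have := congrArg Matrix.det hx
    rw [Matrix.det_mul, Matrix.det_mul] at this
    have he : (!![x₁, x₂, 0, 0; x₃, x₄, 0, 0; 0, 0, x₁, x₂; 0, 0, x₃, x₄] :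
        Matrix (Fin 4) (Fin 4) ℂ).det = (x₁ * x₄ - x₂ * x₃) ^ 2 := by
      simp [Matrix.det_succ_row_zero, Fin.sum_univ_succ, Fin.succAbove]
      ring
    rw [← he, ← this]
    ring
  rw [hx, eq_inv_mul_iff_mul_eq₀ (mul_ne_zero hP.ne_zero hQ.ne_zero), hd]
  simp

end Quadric

/-! ### The classification. -/

theorem Matrix.rank_le_three_of_det_eq_zero {M : Matrix (Fin 4) (Fin 4) ℂ} (h : M.det = 0) :
    M.rank ≤ 3 := by
  by_contra hr
  have h4 : M.rank = 4 := by
    have := M.rank_le_width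
    omega
  have htop : LinearMap.range M.mulVecLin = ⊤ := by
    refine Submodule.eq_top_of_finrank_eq ?_
    rw [Module.finrank_fin_fun]
    exact h4
  have hu : IsUnit M := Matrix.mulVec_surjective_iff_isUnit.1 (LinearMap.range_eq_top.1 htop)
  rw [Matrix.isUnit_iff_isUnit_det, h] at hu
  exact not_isUnit_zero hu

theorem proposition3p7 (E : Submodule ℂ (Matrix (Fin 4) (Fin 4) ℂ))
    {m : ℕ} (b : Module.Basis (Fin m) ℂ E)
    (S : MvPolynomial (Fin m) ℂ) (hirr : Irreducible S) (hdeg : S.totalDegree = 2)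
    (hdvd : ∀ f g : Fin 3 ↪o Fin 4, S ∣ ((linearFormMatrix b).submatrix f g).det) :
    HasBoundedRank E 3 ∨
    (∃ F : Submodule ℂ (Matrix (Fin 4) (Fin 4) ℂ), EqUpToBases E F ∧ IsSkewSpace F) ∨
    (quadricRank S = 3 ∧ EqUpToBases E diagSymmSpace) ∨
    (quadricRank S = 4 ∧ EqUpToBases E diagGeneralSpace) := by
  by_cases hdet0 : (linearFormMatrix b).det = 0
  · refine Or.inl fun M hM => Matrix.rank_le_three_of_det_eq_zero ?_
    have h := eval_det_linearFormMatrix b (b.repr ⟨M, hM⟩)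
    rw [← coe_eq_sum_repr b ⟨M, hM⟩, hdet0, map_zero] at h
    exact h.symm
  right
  obtain ⟨c, hc, hdet, N, hN⟩ := exists_matrix_factorization (linearFormMatrix b) hirr hdeg hdet0
    (totalDegree_det_linearFormMatrix_le b) hdvd
  obtain ⟨M₀, hM₀, hu⟩ : ∃ M₀ ∈ E, IsUnit M₀.det := by
    by_contra! hcon
    refine hdet0 (MvPolynomial.funext fun x => ?_)
    rw [map_zero, eval_det_linearFormMatrix]
    by_contra hx
    exact hcon _ (E.sum_mem fun k _ => E.smul_mem _ (b k).2) (isUnit_iff_ne_zero.2 hx)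
  have hsq := fun (M : Matrix (Fin 4) (Fin 4) ℂ) (hM : M ∈ E) =>
    sq_inv_mul_eq_smul_one b hdet hN hM₀ hM hu
  set E' := E.map (LinearMap.mulLeft ℂ M₀⁻¹) with hE'
  have hone : (1 : Matrix (Fin 4) (Fin 4) ℂ) ∈ E' := ⟨M₀, hM₀, Matrix.nonsing_inv_mul _ hu⟩
  have hsq' : ∀ Y ∈ E', Y.trace = 0 → ∃ d : ℂ, Y * Y = d • (1 : Matrix (Fin 4) (Fin 4) ℂ) := by
    rintro _ ⟨M, hM, rfl⟩ htr
    obtain ⟨d, hd, -⟩ := hsq M hM htr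
    exact ⟨d, hd⟩
  set V := E' ⊓ LinearMap.ker (Matrix.traceLinearMap (Fin 4) ℂ ℂ)
  have hV : ∀ v ∈ V, ∃ d : ℂ, v * v = d • (1 : Matrix (Fin 4) (Fin 4) ℂ) := fun v hv =>
    hsq' v hv.1 hv.2
  rcases mul_self_eq_sq_or_exists_anticommuting hV with ⟨Z, hZ⟩ | ⟨e₁, he₁, e₂, he₂, h₁, h₂, h₁₂⟩
  · exfalso
    -- Making `Z` traceless lets the functional ignore the scalar part of `M₀⁻¹ * M`.
    set Z₀ := Z - (Z.trace / 4) • (1 : Matrix (Fin 4) (Fin 4) ℂ) with hZ₀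
    set φ : Matrix (Fin 4) (Fin 4) ℂ → E →ₗ[ℂ] ℂ := fun K =>
      Matrix.traceLinearMap (Fin 4) ℂ ℂ ∘ₗ LinearMap.mulRight ℂ K ∘ₗ LinearMap.mulLeft ℂ M₀⁻¹ ∘ₗ
        E.subtype
    have hφ : ∀ K (M : E), φ K M = (M₀⁻¹ * M * K).trace := fun K M => rfl
    -- For `M₀⁻¹ * M = t • 1 + v` and `q = (v * Z).trace`, the two forms are `t - q` and `t + q`,
    -- since `det (t • 1 + v) = (t ^ 2 - q ^ 2) ^ 2`.
    refine det_ne_mul_sq_of_irreducible b hirr hdeg hdet hdet0 M₀.det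
      (φ ((1 / 4 : ℂ) • 1 - Z₀)) (φ ((1 / 4 : ℂ) • 1 + Z₀)) fun M => ?_
    set t := (M₀⁻¹ * (M : Matrix (Fin 4) (Fin 4) ℂ)).trace / 4 with ht
    set v := M₀⁻¹ * ((M : Matrix (Fin 4) (Fin 4) ℂ) - t • M₀) with hv
    have hve : M₀⁻¹ * (M : Matrix (Fin 4) (Fin 4) ℂ) = t • 1 + v := by
      rw [hv, mul_sub, mul_smul_comm, Matrix.nonsing_inv_mul _ hu, add_sub_cancel]
    have hmem : (M : Matrix (Fin 4) (Fin 4) ℂ) - t • M₀ ∈ E := E.sub_mem M.2 (E.smul_mem _ hM₀)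
    have hvt : v.trace = 0 := by
      have h := congrArg Matrix.trace hve
      rw [Matrix.trace_add, Matrix.trace_smul, Matrix.trace_one] at h
      simp only [Fintype.card_fin, Nat.cast_ofNat, smul_eq_mul] at h
      linear_combination -h + 4 * ht
    obtain ⟨d, hd, hdd⟩ := hsq _ hmem hvt
    have hdz : d = (v * Z).trace ^ 2 := by
      have h := hZ v ⟨⟨_, hmem, rfl⟩, hvt⟩
      rw [hd] at h
      simpa using congrFun (congrFun h 0) 0
    have hMdet : (M : Matrix (Fin 4) (Fin 4) ℂ).det =
        M₀.det * (t • (1 : Matrix (Fin 4) (Fin 4) ℂ) + v).det := by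
      rw [← hve, ← Matrix.det_mul, ← Matrix.mul_assoc, Matrix.mul_nonsing_inv _ hu,
        Matrix.one_mul]
    have hvZ : (M₀⁻¹ * M * Z₀).trace = (v * Z).trace := by
      rw [hve, hZ₀]
      simp only [mul_sub, add_mul, Matrix.trace_sub, Matrix.trace_add, smul_mul_assoc, one_mul,
        mul_smul_comm, mul_one, Matrix.trace_smul, hvt, Matrix.trace_one, smul_eq_mul,
        Fintype.card_fin]
      push_cast
      ring
    have hone' : (M₀⁻¹ * (M : Matrix (Fin 4) (Fin 4) ℂ) * ((1 / 4 : ℂ) • 1)).trace = t := by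
      rw [mul_smul_comm, mul_one, Matrix.trace_smul, ht, smul_eq_mul]
      ring
    rw [hφ, hφ, mul_sub, mul_add, Matrix.trace_sub, Matrix.trace_add, hvZ, hone', hMdet, hdd, hdz]
    ring
  obtain ⟨P, hP, hP₁, hP₂⟩ := exists_conj_pauli h₁ h₂ h₁₂
  set F := E.map (LinearMap.mulLeft ℂ (P⁻¹ * M₀⁻¹) ∘ₗ LinearMap.mulRight ℂ P) with hF
  have hmemF : ∀ Y ∈ E', P⁻¹ * (Y * P) ∈ F := by
    rintro _ ⟨M, hM, rfl⟩
    refine ⟨M, hM, ?_⟩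
    simp [mul_assoc]
  have hPP : P⁻¹ * P = 1 := Matrix.nonsing_inv_mul _ hP
  have hPP' : P * P⁻¹ = 1 := Matrix.mul_nonsing_inv _ hP
  have hF1 : 1 ∈ F := by simpa [hPP] using hmemF 1 hone
  have hFZ : pauliZ ∈ F := by
    have h := hmemF _ he₁.1
    rwa [hP₁, ← mul_assoc, hPP, one_mul] at h
  have hFX : pauliX ∈ F := by
    have h := hmemF _ he₂.1
    rwa [hP₂, ← mul_assoc, hPP, one_mul] at h
  have hFsq : ∀ Y ∈ F, Y.trace = 0 → ∃ d : ℂ, Y * Y = d • (1 : Matrix (Fin 4) (Fin 4) ℂ) := by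
    rintro _ ⟨M, hM, rfl⟩ htr
    have hconj : (LinearMap.mulLeft ℂ (P⁻¹ * M₀⁻¹) ∘ₗ LinearMap.mulRight ℂ P) M =
        P⁻¹ * (M₀⁻¹ * M) * P := by simp [mul_assoc]
    rw [hconj] at htr ⊢
    rw [Matrix.trace_mul_comm, ← mul_assoc, hPP', one_mul] at htr
    obtain ⟨d, hd⟩ := hsq' _ ⟨M, hM, rfl⟩ htr
    have hd : M₀⁻¹ * M * (M₀⁻¹ * M) = d • 1 := hd
    refine ⟨d, ?_⟩
    calc P⁻¹ * (M₀⁻¹ * M) * P * (P⁻¹ * (M₀⁻¹ * M) * P)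
        = P⁻¹ * (M₀⁻¹ * M * (P * P⁻¹) * (M₀⁻¹ * M)) * P := by simp only [mul_assoc]
      _ = d • 1 := by rw [hPP', mul_one, hd, mul_smul_comm, mul_one, smul_mul_assoc, hPP]
  have hPu : IsUnit P := (Matrix.isUnit_iff_isUnit_det _).2 hP
  have hMu : IsUnit (P⁻¹ * M₀⁻¹) := by
    refine IsUnit.mul ?_ ?_
    · exact (Matrix.isUnit_iff_isUnit_det _).2 (Matrix.isUnit_nonsing_inv_det _ hP)
    · exact (Matrix.isUnit_iff_isUnit_det _).2 (Matrix.isUnit_nonsing_inv_det _ hu)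
  rcases symplecticForm_mul_or_eq_diagGeneralSpace hF1 hFZ hFX hFsq with hskew | hdiag
  · have hJ : IsUnit (symplecticForm * (P⁻¹ * M₀⁻¹)) := by
      refine IsUnit.mul ?_ hMu
      exact (Matrix.isUnit_iff_isUnit_det _).2
        (Matrix.isUnit_det_of_right_inverse symplecticForm_mul_self)
    refine Or.inl ⟨_, ⟨hJ.unit, hPu.unit, rfl⟩, ?_⟩
    rintro _ ⟨M, hM, rfl⟩
    have h := hskew _ ⟨M, hM, rfl⟩
    simpa [mul_assoc] using h
  · refine Or.inr (Or.inr ⟨?_, hMu.unit, hPu.unit, hdiag⟩)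
    exact quadricRank_eq_four_of_map_eq b hc hdet ((Matrix.isUnit_iff_isUnit_det _).1 hMu) hP hdiag
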